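/- A \emph{pretree} is a set $X$ with a ternary relation $\langle a,b,c\rangle$ such that for all $a,b,c,d\in X$: (B1) $\langle a,b,c\rangle\Rightarrow\langle c,b,a\rangle$; (B2) $\langle a,b,c\rangle$ and $\langle a,c,b\rangle$ both hold if and only if $b=c$; (B3) $\langle a,b,c\rangle\Rightarrow\langle a,b,d\rangle$ or $\langle d,b,c\rangle$. Put $[u,v]:=\{x\in X:\langle u,x,v\rangle\}$. The pretree is a \emph{median pretree} if $[a,b]\cap[a,c]\cap[b,c]\neq\emptyset$ for all $a,b,c\in X$; this intersection is then a single point, the median $m(a,b,c)$. The \emph{shadow topology} of $X$ is the topology with subbase of open sets $\{x\in X: u\notin[x,v]\}$, where $u,v\in X$, $u\ne v$. A subset of a median pretree is a \emph{subalgebra} if it is closed under $m$. For a function $f\colon X\to\mathbb R$ and a finite subalgebra $\sigma\subset X$ let $$\Upsilon(f,\sigma):=\sum_{\{a,b\}}|f(a)-f(b)|,$$ where the sum is over all unordered pairs of distinct points $a,b\in\sigma$ with $[a,b]\cap\sigma=\{a,b\}$. A function $f\colon X\to\mathbb R$ has \emph{bounded variation} if it is bounded and there is a real $r>0$ such that $\Upsilon(f):=\sup_\sigma\Upsilon(f,\sigma)\le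 r$, where the supremum is over all finite subalgebras $\sigma$ of $X$. \textbf{Theorem A.} Let $X$ be a median pretree whose shadow topology is compact or Polish (that is, separable and completely metrizable), and equip $X$ with this topology. Let $f\colon X\to\mathbb R$ be a function of bounded variation. Then: (1) $f$ has the point of continuity property: for every nonempty closed $A\subset X$ the restriction $f|_A\colon A\to\mathbb R$ has a point of continuity; (2) $f$ is fragmented: for every nonempty $A\subset X$ and every $\varepsilon>0$ there is an open $O\subset X$ such that $O\cap A\neq\emptyset$ and $\operatorname{diam} f(O\cap A)<\varepsilon$; (3) if $X$ is Polish, then $f$ is of Baire class 1, i.e. the pointwise limit of a sequence of continuous functions $X\to\mathbb R$. -/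

import Mathlib

open Set Filter Topology
open scoped ENNReal

/-- A pretree: a set with a ternary betweenness relation `Between a b c` ("`b` is between `a` and
`c`") satisfying the three axioms below. -/
class Pretree (X : Type*) where
  /-- The betweenness relation `⟨a, b, c⟩`. -/
  Between : X → X → X → Prop
  btw_symm : ∀ a b c, Between a b c → Between c b a
  btw_and_btw_iff : ∀ a b c, (Between a b c ∧ Between a c b) ↔ b = c
  btw_or_btw : ∀ a b c d, Between a b c → (Between a b d ∨ Between d b c)

namespace Pretree

/-- The interval `[u, v] = {x : ⟨u, x, v⟩}`. -/
def interval {X : Type*} [Pretree X] (u v : X) : Set X := {x | Between u x v}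

/-- The shadow `S_u^v = {x : u ∈ [x, v]}` cast by `u` when the light source is at `v`. -/
def shadow {X : Type*} [Pretree X] (u v : X) : Set X := {x | u ∈ interval x v}

/-- The branch `ζ_u^v`, the complement of the shadow `S_u^v`. -/
def branch {X : Type*} [Pretree X] (u v : X) : Set X := (shadow u v)ᶜ

/-- The shadow topology: the branches `ζ_u^v` with `u ≠ v` form a subbase of open sets. -/
abbrev shadowTopology (X : Type*) [Pretree X] : TopologicalSpace X :=
  TopologicalSpace.generateFrom {B | ∃ u v : X, u ≠ v ∧ B = branch u v}

end Pretree

/-- A median pretree: the intersection `[a, b] ∩ [a, c] ∩ [b, c]` is never empty. -/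
class MedianPretree (X : Type*) extends Pretree X where
  nonempty_inter : ∀ a b c : X, (Pretree.interval a b ∩ Pretree.interval a c ∩
    Pretree.interval b c).Nonempty

namespace MedianPretree

open Pretree

/-- The median `m(a, b, c)`, the point of `[a, b] ∩ [a, c] ∩ [b, c]`. -/
noncomputable def median {X : Type*} [MedianPretree X] (a b c : X) : X :=
  (nonempty_inter a b c).some

/-- The intersection `[a, b] ∩ [a, c] ∩ [b, c]` is the singleton of the median. -/
theorem interval_inter_eq {X : Type*} [MedianPretree X] (a b c : X) :
    interval a b ∩ interval a c ∩ interval b c = {median a b c} := by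
  have key : ∀ x y : X, x ∈ interval a b ∩ interval a c ∩ interval b c →
      y ∈ interval a b ∩ interval a c ∩ interval b c → x = y := by
    rintro x y ⟨⟨h1, h2⟩, h3⟩ ⟨⟨k1, k2⟩, k3⟩
    have e : ∀ p : X, Between p x y → Between p y x → x = y :=
      fun p h k => (btw_and_btw_iff p x y).1 ⟨h, k⟩
    have s : ∀ p q r : X, Between p q r → Between r q p := btw_symm
    have g1 := (btw_or_btw _ _ _ y h1).imp_right (s _ _ _)
    have g2 := (btw_or_btw _ _ _ y h2).imp_right (s _ _ _)
    have g3 := (btw_or_btw _ _ _ y h3).imp_right (s _ _ _)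
    have l1 := (btw_or_btw _ _ _ x k1).imp_right (s _ _ _)
    have l2 := (btw_or_btw _ _ _ x k2).imp_right (s _ _ _)
    have l3 := (btw_or_btw _ _ _ x k3).imp_right (s _ _ _)
    have ea := e a
    have eb := e b
    have ec := e c
    tauto
  exact Set.Subset.antisymm
    (fun x hx => key x _ hx (nonempty_inter a b c).some_mem)
    (by rintro x rfl; exact (nonempty_inter a b c).some_mem)

/-- A subalgebra is a median-closed subset. -/
def IsSubalgebra {X : Type*} [MedianPretree X] (S : Set X) : Prop :=
  ∀ a ∈ S, ∀ b ∈ S, ∀ c ∈ S, median a b c ∈ S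

/-- `adj(Y)`: the set of all `Y`-adjacent doublets `{a, b}`, i.e. unordered pairs of distinct
points of `Y` with no further point of `Y` between them. -/
def adj {X : Type*} [MedianPretree X] (Y : Set X) : Set (Sym2 X) :=
  {p | ∃ a b : X, p = s(a, b) ∧ a ∈ Y ∧ b ∈ Y ∧ a ≠ b ∧ ∀ c ∈ Y, Between a c b → c = a ∨ c = b}

/-- The quantity `|f a - f b|` attached to an unordered pair `{a, b}`. -/
def jump {X : Type*} (f : X → ℝ) : Sym2 X → ℝ :=
  Sym2.lift ⟨fun a b => |f a - f b|, fun a b => abs_sub_comm (f a) (f b)⟩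

open Classical in
/-- The variation `Υ(f, σ)` of `f` on a finite set `σ`: the sum of `|f a - f b|` over all
`σ`-adjacent doublets `{a, b}`. -/
noncomputable def variationOn {X : Type*} [MedianPretree X] (f : X → ℝ) (σ : Finset X) : ℝ :=
  ∑ p ∈ σ.sym2 with p ∈ adj (σ : Set X), jump f p

/-- The variation `Υ(f)`: the least upper bound, in `[0, ∞]`, of `Υ(f, σ)` over all finite
subalgebras `σ`. -/
noncomputable def variation {X : Type*} [MedianPretree X] (f : X → ℝ) : ℝ≥0∞ :=
  ⨆ (σ : Finset X) (_ : IsSubalgebra (σ : Set X)), ENNReal.ofReal (variationOn f σ)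

/-- The set `BV_r(X)` of all bounded functions of variation at most `r`. -/
def BVr (X : Type*) [MedianPretree X] (r : ℝ) : Set (X → ℝ) :=
  {f | (∃ C : ℝ, ∀ x, |f x| ≤ C) ∧ variation f ≤ ENNReal.ofReal r}

/-- The set `BV(X)` of all functions of bounded variation. -/
def BV (X : Type*) [MedianPretree X] : Set (X → ℝ) := ⋃ (r : ℝ) (_ : 0 < r), BVr X r

end MedianPretree

/-- A function into a metric space is fragmented if every nonempty subset `A` of the domain has,
for every `ε > 0`, a nonempty relatively open part on which `f` has oscillation less than `ε`
(the diameter is taken in `[0, ∞]`). -/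
def Fragmented {X M : Type*} [TopologicalSpace X] [MetricSpace M] (f : X → M) : Prop :=
  ∀ A : Set X, A.Nonempty → ∀ ε : ℝ, 0 < ε →
    ∃ O : Set X, IsOpen O ∧ (O ∩ A).Nonempty ∧ Metric.ediam (f '' (O ∩ A)) < ENNReal.ofReal ε

/-- The point of continuity property: the restriction of `f` to every nonempty closed subset has
a point of continuity. -/
def PointOfContinuityProperty {X : Type*} [TopologicalSpace X] (f : X → ℝ) : Prop :=
  ∀ A : Set X, IsClosed A → A.Nonempty → ∃ x : A, ContinuousAt (fun y : A => f y) x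

/-- Baire class 1: pointwise limit of a sequence of continuous functions. -/
def BaireClassOne {X : Type*} [TopologicalSpace X] (f : X → ℝ) : Prop :=
  ∃ F : ℕ → X → ℝ, (∀ n, Continuous (F n)) ∧
    ∀ x, Tendsto (fun n => F n x) atTop (𝓝 (f x))

/-!
A function `f` of bounded variation on a median pretree is fragmented, whether or not the shadow
topology is compact or Polish. The branches are convex, so the shadow topology is Hausdorff
(`MedianPretree.t2Space`) with a base of convex open sets
(`Pretree.exists_isConvex_isOpen_subset`). If `f` oscillated by at least `ε` on every open set that
meets some nonempty `A`, then `A` would be infinite, and for each `k` there would be `k` disjoint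
convex open sets `V i` with points `a i, b i` in `V i` such that `ε / 2 < |f (a i) - f (b i)|`. Some
finite subalgebra `σ` contains all these points (`MedianPretree.exists_finite_isSubalgebra`). The
points of `σ` in `[a i, b i]` form a chain of adjacent doublets inside `V i`, so that `f` has
variation at least `k * (ε / 2)` on `σ`, which is impossible for large `k`
(`MedianPretree.fragmented_of_mem_BV`).

The rest holds for fragmented real functions in general. On a closed subset that is a Baire space,
the sets of points near which `f` has small oscillation are dense and open, and a common point of
them is a point of continuity. On a second countable metrizable space, fragmentability yields, for
every `ε > 0`, a countable closed cover on whose members `f` oscillates by at most `ε`. Only finitely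
many of these closed sets are considered at a time; then the constant `f x` satisfies near `x` all
the constraints that they impose on an approximation of `f`, and a partition of unity gives a
continuous approximation.
-/

/-! ### Betweenness and convexity -/

namespace Pretree

variable {X : Type*} [Pretree X] {a b c d u v x : X}

theorem btw_right (a b : X) : Between a b b := ((btw_and_btw_iff a b b).2 rfl).1

theorem btw_left (a b : X) : Between a a b := btw_symm _ _ _ (btw_right b a)

theorem eq_of_btw_of_btw (h : Between a b c) (k : Between a c b) : b = c :=
  (btw_and_btw_iff a b c).1 ⟨h, k⟩

theorem Between.trans (h : Between a d b) (k : Between a b c) : Between a d c := by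
  have h1 := btw_or_btw _ _ _ c h
  have h2 := btw_or_btw _ _ _ d k
  rcases h1 with h1 | h1
  · exact h1
  · rcases h2 with h2 | h2
    · exact eq_of_btw_of_btw h h2 ▸ k
    · exact eq_of_btw_of_btw h1 (btw_symm _ _ _ h2) ▸ k

/-- The points of an interval are linearly ordered by their position as seen from an end. -/
theorem btw_total (h : Between x a c) (k : Between x b c) : Between x a b ∨ Between x b a := by
  rcases btw_or_btw _ _ _ b h with h1 | h1
  · exact .inl h1
  rcases btw_or_btw _ _ _ a k with k1 | k1
  · exact .inr k1
  · have := eq_of_btw_of_btw (btw_symm _ _ _ h1) (btw_symm _ _ _ k1)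
    exact .inl (this ▸ btw_right _ _)

/-- Order convexity: a set containing the interval between any two of its points. -/
def IsConvex (C : Set X) : Prop := ∀ x ∈ C, ∀ y ∈ C, interval x y ⊆ C

theorem isConvex_branch (u v : X) : IsConvex (branch u v) := by
  intro x hx y hy z hz huv
  have hx : ¬ Between x u v := hx
  have hy : ¬ Between y u v := hy
  have hz : Between x z y := hz
  have huv : Between z u v := huv
  have h1 : Between z u x := (btw_or_btw _ _ _ x huv).resolve_right hx
  have h2 : Between z u y := (btw_or_btw _ _ _ y huv).resolve_right hy
  have h3 : z = u := by
    rcases btw_or_btw _ _ _ u hz with h | h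
    · exact eq_of_btw_of_btw h (btw_symm _ _ _ h1)
    · exact eq_of_btw_of_btw (btw_symm _ _ _ h) (btw_symm _ _ _ h2)
  subst h3
  exact (btw_or_btw _ _ _ v hz).elim hx fun h => hy (btw_symm _ _ _ h)

/-- Branches are convex, hence so are the basic open sets of the shadow topology. -/
theorem exists_isConvex_isOpen_subset [τ : TopologicalSpace X] (hτ : τ = shadowTopology X)
    {O : Set X} (hO : IsOpen O) (hx : x ∈ O) :
    ∃ V : Set X, IsOpen V ∧ IsConvex V ∧ x ∈ V ∧ V ⊆ O := by
  have hB := TopologicalSpace.isTopologicalBasis_of_subbasis hτ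
  obtain ⟨V, hV, hxV, hVO⟩ := hB.exists_subset_of_mem_open hx hO
  refine ⟨V, hB.isOpen hV, ?_, hxV, hVO⟩
  obtain ⟨S, ⟨-, hS⟩, rfl⟩ := hV
  intro y hy z hz w hw B hB
  obtain ⟨u, v, -, rfl⟩ := hS hB
  exact isConvex_branch u v y (hy _ hB) z (hz _ hB) hw

theorem isOpen_branch [τ : TopologicalSpace X] (hτ : τ = shadowTopology X) (h : u ≠ v) :
    IsOpen (branch u v) := by
  subst hτ
  exact TopologicalSpace.isOpen_generateFrom_of_mem ⟨u, v, h, rfl⟩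

theorem mem_branch_self (h : u ≠ v) : v ∈ branch u v := by
  intro k
  have k : Between v u v := k
  exact h (eq_of_btw_of_btw k (btw_left v u))

end Pretree

/-! ### Medians and the Hausdorff property -/

namespace MedianPretree

open Pretree

variable {X : Type*} [MedianPretree X]

theorem median_mem (a b c : X) : Between a (median a b c) b ∧ Between a (median a b c) c ∧
    Between b (median a b c) c := by
  have h : median a b c ∈ interval a b ∩ interval a c ∩ interval b c := by
    rw [interval_inter_eq]; rfl
  exact ⟨h.1.1, h.1.2, h.2⟩

theorem eq_median {a b c m : X} (h1 : Between a m b) (h2 : Between a m c) (h3 : Between b m c) :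
    median a b c = m := by
  have h : m ∈ interval a b ∩ interval a c ∩ interval b c := ⟨⟨h1, h2⟩, h3⟩
  rw [interval_inter_eq] at h
  exact h.symm

theorem t2Space [τ : TopologicalSpace X] (hτ : τ = shadowTopology X) : T2Space X := by
  refine ⟨fun a b hab => ?_⟩
  by_cases h : ∃ c, Between a c b ∧ c ≠ a ∧ c ≠ b
  · obtain ⟨c, hc, hca, hcb⟩ := h
    refine ⟨branch c a, branch c b, isOpen_branch hτ hca, isOpen_branch hτ hcb,
      mem_branch_self hca, mem_branch_self hcb, Set.disjoint_left.2 fun x hx hx' => ?_⟩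
    exact (btw_or_btw _ _ _ x hc).elim (fun k => hx (btw_symm _ _ _ k)) hx'
  · -- No third point lies in `[a, b]`, so the median of `a, b, x` is `a` or `b`.
    push Not at h
    refine ⟨branch b a, branch a b, isOpen_branch hτ hab.symm, isOpen_branch hτ hab,
      mem_branch_self hab.symm, mem_branch_self hab, Set.disjoint_left.2 fun x hx hx' => ?_⟩
    obtain ⟨h1, h2, h3⟩ := median_mem a b x
    by_cases hm : median a b x = a
    · rw [hm] at h3
      exact hx' (btw_symm _ _ _ h3)
    · rw [h _ h1 hm] at h2
      exact hx (btw_symm _ _ _ h2)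

/-! ### Finite subalgebras -/

theorem median_right_comm (a b c : X) : median a b c = median a c b := by
  obtain ⟨h1, h2, h3⟩ := median_mem a b c
  exact (eq_median h2 h1 (btw_symm _ _ _ h3)).symm

theorem median_left_comm (a b c : X) : median a b c = median b a c := by
  obtain ⟨h1, h2, h3⟩ := median_mem a b c
  exact (eq_median (btw_symm _ _ _ h1) h3 h2).symm

theorem isSubalgebra_insert {S : Set X} (hS : IsSubalgebra S) {x : X}
    (hx : ∀ c ∈ S, ∀ d ∈ S, median x c d ∈ insert x S) : IsSubalgebra (insert x S) := by
  have hxx : ∀ c, median x x c = x := fun c =>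
    eq_median (btw_left _ _) (btw_left _ _) (btw_left _ _)
  have hxT : ∀ c ∈ insert x S, ∀ d ∈ insert x S, median x c d ∈ insert x S := by
    rintro c (rfl | hc) d (rfl | hd)
    · exact .inl (hxx _)
    · exact .inl (hxx _)
    · rw [median_right_comm]
      exact .inl (hxx _)
    · exact hx c hc d hd
  intro a ha b hb c hc
  rcases ha with rfl | ha'
  · exact hxT b hb c hc
  rcases hb with rfl | hb'
  · rw [median_left_comm]
    exact hxT a (.inr ha') c hc
  rcases hc with rfl | hc'
  · rw [median_right_comm, median_left_comm]
    exact hxT a (.inr ha') b (.inr hb')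
  · exact .inr (hS a ha' b hb' c hc')

/-- The projection of `x` to the convex hull of a nonempty finite set `σ`: among the medians
`m(x, a, b)` with `a` and `b` in `σ`, take one with no other of them between it and `x`. -/
theorem exists_projection {σ : Finset X} (hne : σ.Nonempty) (x : X) :
    ∃ p, (∃ a ∈ σ, ∃ b ∈ σ, Between a p b) ∧ ∀ c ∈ σ, Between x p c := by
  classical
  have hfin : ∀ T : Finset X, T.Nonempty → ∃ p ∈ T, ∀ q ∈ T, Between x q p → q = p := by
    intro T hT
    induction hT using Finset.Nonempty.cons_induction with
    | singleton a => exact ⟨a, by simp, by simp⟩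
    | cons a s ha hs ih =>
      obtain ⟨p, hp, hmin⟩ := ih
      by_cases hap : Between x a p
      · refine ⟨a, by simp, fun q hq hqa => ?_⟩
        rcases Finset.mem_cons.1 hq with rfl | hq
        · rfl
        · have := hmin q hq (hqa.trans hap)
          subst this
          exact eq_of_btw_of_btw hqa hap
      · refine ⟨p, by simp [hp], fun q hq hqp => ?_⟩
        rcases Finset.mem_cons.1 hq with rfl | hq
        · exact absurd hqp hap
        · exact hmin q hq hqp
  obtain ⟨p, hp, hmin⟩ := hfin ((σ ×ˢ σ).image fun q => median x q.1 q.2)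
    ((hne.product hne).image _)
  simp only [Finset.mem_image, Finset.mem_product, Prod.exists] at hp hmin
  obtain ⟨a, b, ⟨ha, hb⟩, rfl⟩ := hp
  obtain ⟨h1, h2, h3⟩ := median_mem x a b
  set p := median x a b
  have key : ∀ a ∈ σ, Between x p a → ∀ c ∈ σ, Between a p c → Between x p c := by
    intro a ha hxa c hc hac
    obtain ⟨k1, k2, k3⟩ := median_mem x a c
    rcases btw_total hxa k1 with h | h
    · exact h.trans k2
    · rwa [hmin _ ⟨a, c, ⟨ha, hc⟩, rfl⟩ h] at k2
  refine ⟨p, ⟨a, ha, b, hb, h3⟩, fun c hc => ?_⟩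
  rcases btw_or_btw _ _ _ c h3 with h | h
  · exact key a ha h1 c hc h
  · exact key b hb h2 c hc (btw_symm _ _ _ h)

/-- Every finite set lies in a finite subalgebra. A point `x` is adjoined to a subalgebra together
with its projection `p` to the convex hull, and no further points are needed, because
`m(x, c, d) = m(p, c, d)` is `p` or a median of points already present. -/
theorem exists_finite_isSubalgebra (F : Finset X) :
    ∃ σ : Finset X, F ⊆ σ ∧ IsSubalgebra (σ : Set X) := by
  classical
  induction F using Finset.induction_on with
  | empty => exact ⟨∅, subset_rfl, by simp [IsSubalgebra]⟩
  | insert x F _ ih =>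
    obtain ⟨σ, hF, hσ⟩ := ih
    rcases σ.eq_empty_or_nonempty with rfl | hne
    · refine ⟨{x}, by simp_all, ?_⟩
      simpa [IsSubalgebra] using eq_median (btw_left x x) (btw_left x x) (btw_left x x)
    obtain ⟨p, ⟨a, ha, b, hb, hab⟩, hp⟩ := exists_projection hne x
    have hpp : ∀ c ∈ σ, ∀ d ∈ σ, median p c d ∈ insert p (σ : Set X) := by
      intro c hc d hd
      by_cases hcd : Between c p d
      · exact .inl (eq_median (btw_left p c) (btw_left p d) hcd)
      -- Some `e ∈ σ` lies beyond `p` as seen from both `c` and `d`.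
      obtain ⟨e, he, hce⟩ : ∃ e ∈ σ, Between c p e := by
        rcases btw_or_btw _ _ _ c hab with h | h
        exacts [⟨a, ha, btw_symm _ _ _ h⟩, ⟨b, hb, h⟩]
      have hde : Between d p e := (btw_or_btw _ _ _ d hce).resolve_left hcd
      obtain ⟨h1, h2, h3⟩ := median_mem c d e
      have k1 : Between c (median c d e) p := (btw_total h2 hce).resolve_right
        fun h => hcd (h.trans h1)
      have k2 : Between d (median c d e) p := (btw_total h3 hde).resolve_right
        fun h => hcd (btw_symm _ _ _ (h.trans (btw_symm _ _ _ h1)))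
      rw [eq_median (btw_symm _ _ _ k1) (btw_symm _ _ _ k2) h1]
      exact .inr (hσ c hc d hd e he)
    have hxp : ∀ c ∈ σ, ∀ d ∈ σ, median x c d = median p c d := by
      intro c hc d hd
      obtain ⟨h1, h2, h3⟩ := median_mem p c d
      exact eq_median (btw_symm _ _ _ ((btw_symm _ _ _ h1).trans (btw_symm _ _ _ (hp c hc))))
        (btw_symm _ _ _ ((btw_symm _ _ _ h2).trans (btw_symm _ _ _ (hp d hd)))) h3
    have hpσ : IsSubalgebra (insert p (σ : Set X)) := isSubalgebra_insert hσ fun c hc d hd => hpp c hc d hd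
    refine ⟨insert x (insert p σ), Finset.insert_subset_insert _
      (hF.trans (Finset.subset_insert _ _)), ?_⟩
    rw [Finset.coe_insert, Finset.coe_insert]
    refine isSubalgebra_insert hpσ fun c hc d hd => .inr ?_
    have hxpc : ∀ c, Between x p c → median x p c = p := fun c hc =>
      eq_median (btw_right _ _) hc (btw_left _ _)
    have hp' : ∀ c ∈ insert p (σ : Set X), Between x p c := by
      rintro c (rfl | hc)
      exacts [btw_right _ _, hp c hc]
    rcases hc with rfl | hc
    · exact .inl (hxpc d (hp' d hd))
    rcases hd with rfl | hd
    · rw [median_right_comm]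
      exact .inl (hxpc c (hp c hc))
    · rw [hxp c hc d hd]
      exact hpp c hc d hd

/-! ### Variation along disjoint convex sets -/

open Classical in
/-- The `σ`-adjacent doublets contained in `C`. -/
noncomputable def adjIn (σ : Finset X) (C : Set X) : Finset (Sym2 X) :=
  {p ∈ σ.sym2 | p ∈ adj (σ : Set X) ∧ ∀ x ∈ p, x ∈ C}

theorem mem_adjIn {σ : Finset X} {C : Set X} {a b : X} : s(a, b) ∈ adjIn σ C ↔
    a ∈ σ ∧ b ∈ σ ∧ s(a, b) ∈ adj (σ : Set X) ∧ a ∈ C ∧ b ∈ C := by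
  simp [adjIn, and_assoc]

theorem adjIn_mono (σ : Finset X) {C D : Set X} (h : C ⊆ D) : adjIn σ C ⊆ adjIn σ D := by
  intro p
  induction p with | _ a b
  rw [mem_adjIn, mem_adjIn]
  exact fun hp => ⟨hp.1, hp.2.1, hp.2.2.1, h hp.2.2.2.1, h hp.2.2.2.2⟩

/-- An adjacent doublet consists of two distinct points. -/
theorem disjoint_adjIn (σ : Finset X) {C D : Set X} (h : (C ∩ D).Subsingleton) :
    Disjoint (adjIn σ C) (adjIn σ D) := by
  rw [Finset.disjoint_left]
  intro p
  induction p with | _ a b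
  rw [mem_adjIn, mem_adjIn]
  intro hp hp'
  obtain ⟨c, d, he, -, -, hne, -⟩ := hp.2.2.1
  have hab : a = b := h ⟨hp.2.2.2.1, hp'.2.2.2.1⟩ ⟨hp.2.2.2.2, hp'.2.2.2.2⟩
  subst hab
  rcases Sym2.eq_iff.1 he with ⟨h1, h2⟩ | ⟨h1, h2⟩
  exacts [hne (h1 ▸ h2), hne (h2 ▸ h1)]

theorem jump_nonneg {Y : Type*} (f : Y → ℝ) (p : Sym2 Y) : 0 ≤ jump f p := by
  induction p with | _ a b => exact abs_nonneg _

/-- The points of `σ` in `[a, b]` form a chain of adjacent doublets from `a` to `b`. -/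
theorem abs_sub_le_sum_adjIn_interval (f : X → ℝ) (σ : Finset X) {a b : X} (ha : a ∈ σ)
    (hb : b ∈ σ) : |f a - f b| ≤ ∑ p ∈ adjIn σ (interval a b), jump f p := by
  classical
  induction hn : (σ.filter (· ∈ interval a b)).card using Nat.strong_induction_on
    generalizing a b with
  | _ n ih =>
  subst hn
  rcases eq_or_ne a b with rfl | hab
  · simpa using Finset.sum_nonneg fun p _ => jump_nonneg f p
  by_cases h : ∃ c ∈ σ, Between a c b ∧ c ≠ a ∧ c ≠ b
  · obtain ⟨c, hc, hacb, hca, hcb⟩ := h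
    have hac : interval a c ⊆ interval a b := fun x hx => Between.trans hx hacb
    have hcbs : interval c b ⊆ interval a b := fun x hx =>
      btw_symm _ _ _ ((btw_symm _ _ _ hx).trans (btw_symm _ _ _ hacb))
    have h1 := ih _ (Finset.card_lt_card (Finset.ssubset_iff_of_subset
      (Finset.monotone_filter_right σ fun x _ hx => hac hx) |>.2
        ⟨b, Finset.mem_filter.2 ⟨hb, btw_right a b⟩, fun hx => hcb
          (eq_of_btw_of_btw hacb (Finset.mem_filter.1 hx).2)⟩)) ha hc rfl
    have h2 := ih _ (Finset.card_lt_card (Finset.ssubset_iff_of_subset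
      (Finset.monotone_filter_right σ fun x _ hx => hcbs hx) |>.2
        ⟨a, Finset.mem_filter.2 ⟨ha, btw_left a b⟩, fun hx => hca
          (eq_of_btw_of_btw (btw_symm _ _ _ hacb)
            (btw_symm _ _ _ (Finset.mem_filter.1 hx).2))⟩)) hc hb rfl
    have hsub : (interval a c ∩ interval c b).Subsingleton := by
      have key : ∀ x ∈ interval a c ∩ interval c b, x = c := by
        rintro x ⟨hx1, hx2⟩
        have hx1 : Between a x c := hx1
        have hx2 : Between c x b := hx2
        rcases btw_or_btw _ _ _ x hacb with k | k
        · exact eq_of_btw_of_btw hx1 k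
        · exact eq_of_btw_of_btw (btw_symm _ _ _ hx2) (btw_symm _ _ _ k)
      exact fun x hx y hy => (key x hx).trans (key y hy).symm
    calc |f a - f b| ≤ |f a - f c| + |f c - f b| := abs_sub_le _ _ _
      _ ≤ _ := add_le_add h1 h2
      _ = ∑ p ∈ adjIn σ (interval a c) ∪ adjIn σ (interval c b), jump f p :=
        (Finset.sum_union (disjoint_adjIn σ hsub)).symm
      _ ≤ _ := Finset.sum_le_sum_of_subset_of_nonneg
        (Finset.union_subset (adjIn_mono σ hac) (adjIn_mono σ hcbs))
        fun p _ _ => jump_nonneg f p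
  · push Not at h
    have hmem : s(a, b) ∈ adjIn σ (interval a b) := mem_adjIn.2 ⟨ha, hb,
      ⟨a, b, rfl, ha, hb, hab, fun c hc hacb => or_iff_not_imp_left.2 (h c hc hacb)⟩,
      btw_left a b, btw_right a b⟩
    exact Finset.single_le_sum (f := jump f) (fun p _ => jump_nonneg f p) hmem

theorem variationOn_le {f : X → ℝ} {r : ℝ} (hr : 0 ≤ r) (hf : variation f ≤ ENNReal.ofReal r)
    {σ : Finset X} (hσ : IsSubalgebra (σ : Set X)) : variationOn f σ ≤ r :=
  (ENNReal.ofReal_le_ofReal_iff hr).1 ((le_iSup₂ (f := fun (σ : Finset X)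
    (_ : IsSubalgebra (σ : Set X)) => ENNReal.ofReal (variationOn f σ)) σ hσ).trans hf)

/-- In a subalgebra containing all `a i` and `b i`, the chains from `a i` to `b i` use different
adjacent doublets, because they run in disjoint sets. -/
theorem sum_abs_sub_le_of_pairwiseDisjoint {f : X → ℝ} {r : ℝ} (hr : 0 ≤ r)
    (hf : variation f ≤ ENNReal.ofReal r) {ι : Type*} (s : Finset ι) (C : ι → Set X)
    (hC : ∀ i ∈ s, IsConvex (C i)) (hd : (s : Set ι).PairwiseDisjoint C) (a b : ι → X)
    (ha : ∀ i ∈ s, a i ∈ C i) (hb : ∀ i ∈ s, b i ∈ C i) : ∑ i ∈ s, |f (a i) - f (b i)| ≤ r := by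
  classical
  obtain ⟨σ, hsub, hσ⟩ := exists_finite_isSubalgebra (s.image a ∪ s.image b)
  have haσ : ∀ i ∈ s, a i ∈ σ := fun i hi =>
    hsub (Finset.mem_union_left _ (Finset.mem_image_of_mem a hi))
  have hbσ : ∀ i ∈ s, b i ∈ σ := fun i hi =>
    hsub (Finset.mem_union_right _ (Finset.mem_image_of_mem b hi))
  calc ∑ i ∈ s, |f (a i) - f (b i)| ≤ ∑ i ∈ s, ∑ p ∈ adjIn σ (C i), jump f p :=
        Finset.sum_le_sum fun i hi =>
          (abs_sub_le_sum_adjIn_interval f σ (haσ i hi) (hbσ i hi)).trans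
          (Finset.sum_le_sum_of_subset_of_nonneg
            (adjIn_mono σ (hC i hi _ (ha i hi) _ (hb i hi))) fun p _ _ => jump_nonneg f p)
    _ = ∑ p ∈ s.biUnion fun i => adjIn σ (C i), jump f p :=
        (Finset.sum_biUnion fun i hi j hj hij => disjoint_adjIn σ
          ((disjoint_iff_inter_eq_empty.1 (hd hi hj hij)) ▸ subsingleton_empty)).symm
    _ ≤ variationOn f σ := by
        refine Finset.sum_le_sum_of_subset_of_nonneg (fun p hp => ?_) fun p _ _ => jump_nonneg f p
        obtain ⟨i, -, hp⟩ := Finset.mem_biUnion.1 hp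
        have hp := Finset.mem_filter.1 hp
        exact Finset.mem_filter.2 ⟨hp.1, hp.2.1⟩
    _ ≤ r := variationOn_le hr hf hσ

/-- If `f` oscillates by at least `ε` on each open set that meets `A`, then `A` has no isolated
points, so there are arbitrarily many disjoint convex open sets that meet `A`. Each of them
contributes more than `ε / 2` to the variation. -/
theorem fragmented_of_mem_BV [τ : TopologicalSpace X] (hτ : τ = shadowTopology X) {f : X → ℝ}
    (hf : f ∈ BV X) : Fragmented f := by
  obtain ⟨r, hr, -, hvar⟩ : ∃ r : ℝ, 0 < r ∧ f ∈ BVr X r := by simpa [BV] using hf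
  have := t2Space hτ
  intro A hA ε hε
  by_contra! hbad
  have hosc : ∀ O : Set X, IsOpen O → (O ∩ A).Nonempty →
      ∃ a ∈ O ∩ A, ∃ b ∈ O ∩ A, ε / 2 < |f a - f b| := by
    intro O hO hne
    by_contra! hle
    refine (hbad O hO hne).not_gt (lt_of_le_of_lt (Metric.ediam_image_le_iff.2 fun a ha b hb => ?_)
      ((ENNReal.ofReal_lt_ofReal_iff hε).2 (half_lt_self hε)))
    rw [edist_dist]
    exact ENNReal.ofReal_le_ofReal (hle a ha b hb)
  have hinf : A.Infinite := by
    intro hfin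
    obtain ⟨x, hx⟩ := hA
    obtain ⟨a, ha, b, hb, hab⟩ := hosc (A \ {x})ᶜ (hfin.sdiff.isClosed.isOpen_compl)
      ⟨x, by simp, hx⟩
    have key : ∀ y ∈ (A \ {x})ᶜ ∩ A, y = x := fun y hy => by_contra fun h => hy.1 ⟨hy.2, h⟩
    rw [key a ha, key b hb, sub_self, abs_zero] at hab
    linarith
  obtain ⟨k, hk⟩ := exists_nat_gt (r / (ε / 2))
  obtain ⟨s, hsA, hsk⟩ := hinf.exists_subset_card_eq k
  obtain ⟨U, hU, hUd⟩ := s.finite_toSet.t2_separation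
  choose V hVo hVc hxV hVU using fun x => exists_isConvex_isOpen_subset hτ (hU x).2 (hU x).1
  choose! a ha b hb hab using fun x (hx : x ∈ s) => hosc (V x) (hVo x) ⟨x, hxV x, hsA hx⟩
  have hle := sum_abs_sub_le_of_pairwiseDisjoint hr.le hvar s V (fun x _ => hVc x)
    (hUd.mono_on fun x _ => hVU x) a b (fun x hx => (ha x hx).1) fun x hx => (hb x hx).1
  have hge : (k : ℝ) * (ε / 2) ≤ ∑ x ∈ s, |f (a x) - f (b x)| := by
    rw [← hsk, ← nsmul_eq_mul]
    exact Finset.card_nsmul_le_sum s _ _ fun x hx => (hab x hx).le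
  rw [div_lt_iff₀ (half_pos hε)] at hk
  linarith

end MedianPretree

/-! ### Fragmented real functions -/

theorem Fragmented.exists_isOpen_forall_dist_le {X M : Type*} [TopologicalSpace X] [MetricSpace M]
    {f : X → M} (hf : Fragmented f) {A : Set X} (hA : A.Nonempty) {ε : ℝ} (hε : 0 < ε) :
    ∃ O : Set X, IsOpen O ∧ (O ∩ A).Nonempty ∧
      ∀ x ∈ O ∩ A, ∀ y ∈ O ∩ A, dist (f x) (f y) ≤ ε := by
  obtain ⟨O, hO, hne, hd⟩ := hf A hA ε hε
  refine ⟨O, hO, hne, fun x hx y hy => ?_⟩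
  rw [← ENNReal.ofReal_le_ofReal_iff hε.le, ← edist_dist]
  exact (Metric.edist_le_ediam_of_mem (mem_image_of_mem f hx) (mem_image_of_mem f hy)).trans hd.le

/-- In a hereditarily Baire space fragmentability gives points of continuity: within `A`, the
points near which `f` oscillates by at most `1 / (n + 1)` form a dense open set. -/
theorem Fragmented.pointOfContinuityProperty {X : Type*} [TopologicalSpace X] {f : X → ℝ}
    (hf : Fragmented f) (hX : ∀ A : Set X, IsClosed A → BaireSpace A) :
    PointOfContinuityProperty f := by
  intro A hA hne
  have := hX A hA
  have := hne.to_subtype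
  let G : ℕ → Set A := fun n => ⋃₀ {U | IsOpen U ∧
    ∀ x ∈ U, ∀ y ∈ U, dist (f x) (f y) ≤ 1 / ((n : ℝ) + 1)}
  have hGo : ∀ n, IsOpen (G n) := fun n => isOpen_sUnion fun U hU => hU.1
  have hGd : ∀ n, Dense (G n) := by
    intro n
    rw [dense_iff_inter_open]
    rintro V hV ⟨v, hv⟩
    obtain ⟨W, hW, rfl⟩ := isOpen_induced_iff.1 hV
    obtain ⟨O, hO, ⟨x, hxO, hxA, hxW⟩, hd⟩ := hf.exists_isOpen_forall_dist_le
      (A := A ∩ W) ⟨v, v.2, hv⟩ (Nat.one_div_pos_of_nat (α := ℝ) (n := n))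
    refine ⟨⟨x, hxA⟩, hxW, Subtype.val ⁻¹' (O ∩ W),
      ⟨(hO.inter hW).preimage continuous_subtype_val, ?_⟩, hxO, hxW⟩
    exact fun y hy z hz => hd y ⟨hy.1, y.2, hy.2⟩ z ⟨hz.1, z.2, hz.2⟩
  obtain ⟨x, hx⟩ := (dense_iInter_of_isOpen_nat hGo hGd).nonempty
  refine ⟨x, Metric.continuousAt_iff'.2 fun ε hε => ?_⟩
  obtain ⟨n, hn⟩ := exists_nat_one_div_lt hε
  obtain ⟨U, ⟨hU, hd⟩, hxU⟩ := mem_iInter.1 hx n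
  filter_upwards [hU.mem_nhds hxU] with y hy
  exact (hd y hy x hxU).trans_lt hn

/-- A fragmented function on a second countable space has small oscillation on the pieces of a
countable closed cover. The largest open set that can be covered in this way exists by the
Lindelöf property, and fragmentability of `f` on its complement shows that it is everything. -/
theorem Fragmented.exists_countable_closed_cover {X M : Type*} [TopologicalSpace X]
    [SecondCountableTopology X] [TopologicalSpace.PseudoMetrizableSpace X] [MetricSpace M]
    {f : X → M} (hf : Fragmented f) {ε : ℝ} (hε : 0 < ε) :
    ∃ S : Set (Set X), S.Countable ∧
      (∀ F ∈ S, IsClosed F ∧ ∀ x ∈ F, ∀ y ∈ F, dist (f x) (f y) ≤ ε) ∧ ⋃₀ S = univ := by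
  let Small : Set X → Prop := fun F => IsClosed F ∧ ∀ x ∈ F, ∀ y ∈ F, dist (f x) (f y) ≤ ε
  let Good : Set X → Prop := fun U => ∃ S : Set (Set X), S.Countable ∧ (∀ F ∈ S, Small F) ∧
    U ⊆ ⋃₀ S
  have hUnion : ∀ T : Set (Set X), T.Countable → (∀ U ∈ T, Good U) → Good (⋃₀ T) := by
    intro T hT hgood
    choose! S hSc hS hUS using hgood
    refine ⟨⋃ U ∈ T, S U, hT.biUnion hSc, ?_, sUnion_subset fun U hU => ?_⟩
    · intro F hF
      obtain ⟨U, hU, hFU⟩ := mem_iUnion₂.1 hF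
      exact hS U hU F hFU
    · exact (hUS U hU).trans (sUnion_subset_sUnion (subset_biUnion_of_mem (u := S) hU))
  obtain ⟨T, hTc, hT, hTeq⟩ := TopologicalSpace.isOpen_sUnion_countable
    {U : Set X | IsOpen U ∧ Good U} fun U hU => hU.1
  have hG : Good (⋃₀ {U : Set X | IsOpen U ∧ Good U}) :=
    hTeq ▸ hUnion T hTc fun U hU => (hT hU).2
  set G := ⋃₀ {U : Set X | IsOpen U ∧ Good U} with hGdef
  have hGo : IsOpen G := isOpen_sUnion fun U hU => hU.1
  have hGuniv : G = univ := by
    by_contra hne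
    obtain ⟨O, hO, ⟨x, hxO, hxG⟩, hd⟩ :=
      hf.exists_isOpen_forall_dist_le (A := Gᶜ) (nonempty_compl.2 hne) hε
    let := TopologicalSpace.pseudoMetrizableSpacePseudoMetric X
    obtain ⟨F, hFc, hFO, hFeq, -⟩ := hO.exists_iUnion_isClosed
    obtain ⟨S, hSc, hS, hGS⟩ := hG
    refine hxG (mem_sUnion.2 ⟨O ∪ G, ⟨hO.union hGo, S ∪ range fun n => F n ∩ Gᶜ,
      hSc.union (countable_range _), ?_, ?_⟩, .inl hxO⟩)
    · rintro _ (h | ⟨n, rfl⟩)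
      · exact hS _ h
      · exact ⟨(hFc n).inter hGo.isClosed_compl,
          fun y hy z hz => hd y ⟨hFO n hy.1, hy.2⟩ z ⟨hFO n hz.1, hz.2⟩⟩
    · intro y hy
      rw [sUnion_union]
      by_cases hyG : y ∈ G
      · exact .inl (hGS hyG)
      · obtain ⟨n, hn⟩ := mem_iUnion.1 (hFeq.symm ▸ hy.resolve_right hyG : y ∈ ⋃ n, F n)
        exact .inr ⟨_, ⟨n, rfl⟩, hn, hyG⟩
  obtain ⟨S, hSc, hS, hGS⟩ := hG
  exact ⟨S, hSc, hS, univ_subset_iff.1 (hGuniv ▸ hGS)⟩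

/-- The `n`-th approximant is a continuous selection that, on each of the first `n` sets of a
countable closed cover with arbitrarily small oscillations, stays as close to `f` as the
oscillation of `f` on that set allows. -/
theorem Fragmented.baireClassOne {X : Type*} [TopologicalSpace X] [SecondCountableTopology X]
    [TopologicalSpace.MetrizableSpace X] {f : X → ℝ} (hf : Fragmented f) : BaireClassOne f := by
  choose S hSc hS hScov using fun j : ℕ =>
    hf.exists_countable_closed_cover (Nat.one_div_pos_of_nat (α := ℝ) (n := j))
  -- The empty set is added only in order to have a nonempty family to enumerate.
  obtain ⟨K, hK⟩ := ((countable_iUnion hSc).insert ∅).exists_eq_range (insert_nonempty _ _)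
  have hKc : ∀ i, IsClosed (K i) := by
    intro i
    have hi : K i ∈ insert ∅ (⋃ j, S j) := hK ▸ mem_range_self i
    rcases hi with h | h
    · exact h ▸ isClosed_empty
    · obtain ⟨j, hj⟩ := mem_iUnion.1 h
      exact (hS j _ hj).1
  let t : ℕ → X → Set ℝ := fun n x => ⋂ (i ≤ n) (_ : x ∈ K i) (δ : ℝ)
    (_ : ∀ y ∈ K i, ∀ z ∈ K i, dist (f y) (f z) ≤ δ) (y ∈ K i), Metric.closedBall (f y) δ
  have ht : ∀ n x, Convex ℝ (t n x) := fun n x =>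
    convex_iInter₂ fun _ _ => convex_iInter₂ fun _ _ => convex_iInter₂ fun _ _ =>
      convex_iInter fun _ => convex_closedBall _ _
  let := TopologicalSpace.metrizableSpaceMetric X
  have hex : ∀ n, ∃ g : C(X, ℝ), ∀ x, g x ∈ t n x := by
    intro n
    refine exists_continuous_forall_mem_convex_of_local_const (ht n) fun x => ⟨f x, ?_⟩
    have hnear : ∀ᶠ y in 𝓝 x, ∀ i ∈ Finset.range (n + 1), y ∈ K i → x ∈ K i := by
      rw [Filter.eventually_all_finset]
      intro i _
      by_cases hx : x ∈ K i
      · exact .of_forall fun _ _ => hx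
      · filter_upwards [(hKc i).isOpen_compl.mem_nhds hx] with y hy h using absurd h hy
    filter_upwards [hnear] with y hy
    simp only [t, mem_iInter, Metric.mem_closedBall]
    intro i hi hyi δ hδ z hz
    exact hδ x (hy i (Finset.mem_range.2 (Nat.lt_succ_of_le hi)) hyi) z hz
  choose g hg using hex
  refine ⟨fun n => g n, fun n => (g n).continuous, fun x => Metric.tendsto_atTop.2 fun ε hε => ?_⟩
  obtain ⟨j, hj⟩ := exists_nat_one_div_lt hε
  obtain ⟨F, hF, hxF⟩ := mem_sUnion.1 (hScov j ▸ mem_univ x : x ∈ ⋃₀ S j)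
  have hFK : F ∈ range K := hK ▸ mem_insert_of_mem _ (mem_iUnion.2 ⟨j, hF⟩)
  obtain ⟨N, rfl⟩ := hFK
  refine ⟨N, fun n hn => ?_⟩
  have := hg n x
  simp only [t, mem_iInter, Metric.mem_closedBall] at this
  exact (this N hn hxF _ (hS j _ hF).2 x hxF).trans_lt hj

/-! ### Functions of bounded variation -/

theorem theoremA {X : Type*} [MedianPretree X] [τ : TopologicalSpace X]
    (hτ : τ = Pretree.shadowTopology X) (hX : CompactSpace X ∨ PolishSpace X)
    (f : X → ℝ) (hf : f ∈ MedianPretree.BV X) :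
    PointOfContinuityProperty f ∧ Fragmented f ∧ (PolishSpace X → BaireClassOne f) := by
  have hfrag := MedianPretree.fragmented_of_mem_BV hτ hf
  have := MedianPretree.t2Space hτ
  refine ⟨hfrag.pointOfContinuityProperty fun A hA => ?_, hfrag, fun _ => hfrag.baireClassOne⟩
  rcases hX with _ | _
  · have := isCompact_iff_compactSpace.1 hA.isCompact
    infer_instance
  · have := hA.polishSpace
    infer_instance
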